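/- Let $(\bar M,\bar g)$ be a finite-dimensional smooth semi-Riemannian manifold (of constant index) with Levi-Civita connection $\bar\nabla$, and let $\bar J$ be a smooth $(1,1)$-tensor field on $\bar M$ with $\bar J^2=3\bar J+I$, $\bar g(X,\bar JY)=\bar g(\bar JX,Y)$ and $\bar\nabla\bar J=0$ (so $(\bar M,\bar g,\bar J)$ is a locally bronze semi-Riemannian manifold). Let $\bar\Omega$ be an $(l,m)$-type connection on $\bar M$: a linear connection whose torsion is $$\bar T(X,Y)=l\{\theta(Y)X-\theta(X)Y\}+m\{\theta(Y)\bar JX-\theta(X)\bar JY\},$$ where $l,m$ are smooth functions, not both identically zero, and $\theta=\bar g(\cdot,\eta)$ for a smooth unit spacelike vector field $\eta$; for instance $\bar\Omega_XY=\bar\nabla_XY+\theta(Y)\{lX+m\bar JX\}$. Let $M$ be an immersed $r$-lightlike submanifold of $\bar M$: $Rad(TM)=TM\cap TM^{\perp}$ is a smooth distribution of constant rank $r>0$. Fix a screen distribution $S(TM)$ and a screen transversal bundle $S(TM^\perp)$, i.e. smooth subbundles with $TM=Rad(TM)\perp S(TM)$ and $TM^\perp=Rad(TM)\perp S(TM^\perp)$,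 and a lightlike transversal bundle $ltr(TM)$, i.e. a smooth totally null subbundle with $(S(TM)\perp S(TM^\perp))^\perp=Rad(TM)\oplus ltr(TM)$; then $T\bar M|_M=TM\oplus ltr(TM)\oplus S(TM^\perp)$. For vector fields $X,Y$ on $M$ decompose accordingly $$\bar\Omega_XY=\Omega_XY+\bar h^l(X,Y)+\bar h^s(X,Y),$$ where $\Omega$ is the induced connection on $M$, and $\bar h^l$, $\bar h^s$ are the lightlike and the screen second fundamental forms. Assume that $M$ is screen generic: $\bar J(Rad(TM))=Rad(TM)$, and $B_o=\bar J(S(TM))\cap S(TM)$ is a smooth nondegenerate distribution on $M$. Put $B=B_o\perp Rad(TM)$. Then $B$ defines a totally geodesic foliation in $\bar M$ with respect to $\bar\Omega$, i.e. $[X,Y]\in\Gamma(B)$ and $\bar\Omega_XY\in\Gamma(B)$ for all $X,Y\in\Gamma(B)$, if and only if both of the following hold: 1. $M$ is $B$-geodesic, i.e. $\bar h^l(X,Y)=\bar h^s(X,Y)=0$ for all $X,Y\in\Gamma(B)$; 2. $B$ is parallel with respect to the induced connection, i.e. $\Omega_XY\in\Gamma(B)$ for all $X,Y\in\Gamma(B)$.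 -/

import Mathlib

open Bundle Set
open scoped Manifold ContDiff

noncomputable section

namespace LightlikeGeometry

/-! ## Ambient geometry -/

section Ambient

variable {E' : Type*} [NormedAddCommGroup E'] [NormedSpace ℝ E'] [FiniteDimensional ℝ E']
  {N : Type*} [TopologicalSpace N] [ChartedSpace E' N] [IsManifold 𝓘(ℝ, E') ∞ N]

variable (E' N) in
/-- A semi-Riemannian metric on the manifold `N` (modelled on `E'`, without boundary): a smooth
field of symmetric nondegenerate bilinear forms on the tangent spaces, of constant index.
The index at `x` is the largest dimension of a subspace on which the form is negative definite. -/
structure SemiRiemannianMetric where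
  inner (x : N) : TangentSpace 𝓘(ℝ, E') x →L[ℝ] TangentSpace 𝓘(ℝ, E') x →L[ℝ] ℝ
  symm (x : N) (v w : TangentSpace 𝓘(ℝ, E') x) : inner x v w = inner x w v
  nondegenerate (x : N) (v : TangentSpace 𝓘(ℝ, E') x) (hv : ∀ w, inner x v w = 0) : v = 0
  contMDiff : ContMDiff 𝓘(ℝ, E') (𝓘(ℝ, E').prod 𝓘(ℝ, E' →L[ℝ] E' →L[ℝ] ℝ)) ∞
    (fun x : N ↦ (TotalSpace.mk' (E' →L[ℝ] E' →L[ℝ] ℝ) x (inner x) :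
      TotalSpace (E' →L[ℝ] E' →L[ℝ] ℝ)
        (fun x : N ↦ TangentSpace 𝓘(ℝ, E') x →L[ℝ] TangentSpace 𝓘(ℝ, E') x →L[ℝ] ℝ)))
  index : ℕ
  isIndex (x : N) : IsGreatest
    {k | ∃ W : Submodule ℝ (TangentSpace 𝓘(ℝ, E') x),
      (∀ v ∈ W, v ≠ 0 → inner x v v < 0) ∧ Module.finrank ℝ W = k} index

/-- The metric at a point, as a bilinear form. -/
def SemiRiemannianMetric.bilin (g : SemiRiemannianMetric E' N) (x : N) :
    LinearMap.BilinForm ℝ (TangentSpace 𝓘(ℝ, E') x) :=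
  LinearMap.mk₂ ℝ (fun v w ↦ g.inner x v w) (by simp) (by simp) (by simp) (by simp)

/-- `nabla` is the Levi-Civita connection of `g`: torsion free and metric. -/
structure IsLeviCivita (g : SemiRiemannianMetric E' N)
    (nabla : CovariantDerivative 𝓘(ℝ, E') E' (TangentSpace 𝓘(ℝ, E') : N → Type _)) : Prop where
  torsion_eq_zero : nabla.torsion = 0
  metric : ∀ (x : N) (Y Z : Π x : N, TangentSpace 𝓘(ℝ, E') x),
    MDifferentiableAt 𝓘(ℝ, E') 𝓘(ℝ, E').tangent
      (fun y ↦ (⟨y, Y y⟩ : TangentBundle 𝓘(ℝ, E') N)) x →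
    MDifferentiableAt 𝓘(ℝ, E') 𝓘(ℝ, E').tangent
      (fun y ↦ (⟨y, Z y⟩ : TangentBundle 𝓘(ℝ, E') N)) x →
    ∀ v : TangentSpace 𝓘(ℝ, E') x,
      mvfderiv 𝓘(ℝ, E') (fun y ↦ g.inner y (Y y) (Z y)) x v =
        g.inner x (nabla Y x v) (Z x) + g.inner x (Y x) (nabla Z x v)

/-- `(N, g, J)` is a locally bronze semi-Riemannian manifold: `J` is a smooth `(1,1)`-tensor field
with `J² = 3 J + I`, `g(X, J Y) = g(J X, Y)`, and `J` is parallel for the Levi-Civita connection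
`nabla` of `g`, i.e. `∇_v (J Y) = J (∇_v Y)`. -/
structure IsLocallyBronze (g : SemiRiemannianMetric E' N)
    (nabla : CovariantDerivative 𝓘(ℝ, E') E' (TangentSpace 𝓘(ℝ, E') : N → Type _))
    (J : Π x : N, TangentSpace 𝓘(ℝ, E') x →L[ℝ] TangentSpace 𝓘(ℝ, E') x) : Prop where
  contMDiff : ContMDiff 𝓘(ℝ, E') (𝓘(ℝ, E').prod 𝓘(ℝ, E' →L[ℝ] E')) ∞
    (fun x : N ↦ (TotalSpace.mk' (E' →L[ℝ] E') x (J x) :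
      TotalSpace (E' →L[ℝ] E')
        (fun x : N ↦ TangentSpace 𝓘(ℝ, E') x →L[ℝ] TangentSpace 𝓘(ℝ, E') x)))
  bronze : ∀ (x : N) (v : TangentSpace 𝓘(ℝ, E') x), J x (J x v) = (3 : ℝ) • J x v + v
  compatible : ∀ (x : N) (v w : TangentSpace 𝓘(ℝ, E') x),
    g.inner x v (J x w) = g.inner x (J x v) w
  isLeviCivita : IsLeviCivita g nabla
  parallel : ∀ (x : N) (Y : Π x : N, TangentSpace 𝓘(ℝ, E') x),
    MDifferentiableAt 𝓘(ℝ, E') 𝓘(ℝ, E').tangent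
      (fun y ↦ (⟨y, Y y⟩ : TangentBundle 𝓘(ℝ, E') N)) x →
    ∀ v : TangentSpace 𝓘(ℝ, E') x, nabla (fun y ↦ J y (Y y)) x v = J x (nabla Y x v)

/-- `Omega` is an `(l,m)`-type connection on `(N, g)` for the `(1,1)`-tensor field `J`, with
characteristic vector field `eta`: `l, m` are smooth functions, not both identically zero, `eta` is
a smooth unit spacelike vector field, and, with `θ(X) = g(X, eta)`, the torsion of `Omega` is
`T(X,Y) = l {θ(Y) X - θ(X) Y} + m {θ(Y) J X - θ(X) J Y}`. -/
structure IsLMConnection (g : SemiRiemannianMetric E' N)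
    (J : Π x : N, TangentSpace 𝓘(ℝ, E') x →L[ℝ] TangentSpace 𝓘(ℝ, E') x)
    (eta : Π x : N, TangentSpace 𝓘(ℝ, E') x) (l m : N → ℝ)
    (Omega : CovariantDerivative 𝓘(ℝ, E') E' (TangentSpace 𝓘(ℝ, E') : N → Type _)) : Prop where
  contMDiff_l : ContMDiff 𝓘(ℝ, E') 𝓘(ℝ, ℝ) ∞ l
  contMDiff_m : ContMDiff 𝓘(ℝ, E') 𝓘(ℝ, ℝ) ∞ m
  ne_zero : (l, m) ≠ (0, 0)
  contMDiff_eta : ContMDiff 𝓘(ℝ, E') 𝓘(ℝ, E').tangent ∞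
    (fun x ↦ (⟨x, eta x⟩ : TangentBundle 𝓘(ℝ, E') N))
  unit_eta : ∀ x, g.inner x (eta x) (eta x) = 1
  torsion_eq : ∀ (x : N) (v w : TangentSpace 𝓘(ℝ, E') x),
    Omega.torsion x v w =
      l x • (g.inner x w (eta x) • v - g.inner x v (eta x) • w) +
      m x • (g.inner x w (eta x) • J x v - g.inner x v (eta x) • J x w)

/-- The connection `Ω_X Y = ∇_X Y + θ(Y) {l X + m J X}`, with `θ(X) = g(X, eta)`. -/
def lmConnection (g : SemiRiemannianMetric E' N)
    (nabla : CovariantDerivative 𝓘(ℝ, E') E' (TangentSpace 𝓘(ℝ, E') : N → Type _))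
    (J : Π x : N, TangentSpace 𝓘(ℝ, E') x →L[ℝ] TangentSpace 𝓘(ℝ, E') x)
    (eta : Π x : N, TangentSpace 𝓘(ℝ, E') x) (l m : N → ℝ) :
    CovariantDerivative 𝓘(ℝ, E') E' (TangentSpace 𝓘(ℝ, E') : N → Type _) :=
  nabla.addOneForm fun x ↦ (g.inner x (eta x)).smulRight
    (l x • ContinuousLinearMap.id ℝ (TangentSpace 𝓘(ℝ, E') x) + m x • J x)

/-- The connection `∇ + θ ⊗ (l I + m J)` built from the Levi-Civita connection is of `(l,m)`-type. -/
theorem isLMConnection_lmConnection (g : SemiRiemannianMetric E' N)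
    (nabla : CovariantDerivative 𝓘(ℝ, E') E' (TangentSpace 𝓘(ℝ, E') : N → Type _))
    (hnabla : IsLeviCivita g nabla)
    (J : Π x : N, TangentSpace 𝓘(ℝ, E') x →L[ℝ] TangentSpace 𝓘(ℝ, E') x)
    (eta : Π x : N, TangentSpace 𝓘(ℝ, E') x) (l m : N → ℝ)
    (hl : ContMDiff 𝓘(ℝ, E') 𝓘(ℝ, ℝ) ∞ l) (hm : ContMDiff 𝓘(ℝ, E') 𝓘(ℝ, ℝ) ∞ m)
    (hlm : (l, m) ≠ (0, 0))
    (heta : ContMDiff 𝓘(ℝ, E') 𝓘(ℝ, E').tangent ∞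
      (fun x ↦ (⟨x, eta x⟩ : TangentBundle 𝓘(ℝ, E') N)))
    (heta1 : ∀ x, g.inner x (eta x) (eta x) = 1) :
    IsLMConnection g J eta l m (lmConnection g nabla J eta l m) where
  contMDiff_l := hl
  contMDiff_m := hm
  ne_zero := hlm
  contMDiff_eta := heta
  unit_eta := heta1
  torsion_eq x v w := by
    have h0 : nabla.torsion x v w = 0 := by rw [hnabla.torsion_eq_zero]; rfl
    rw [CovariantDerivative.torsion_apply_eq_extend] at h0 ⊢
    have key : ∀ (Y : Π x : N, TangentSpace 𝓘(ℝ, E') x) (u : TangentSpace 𝓘(ℝ, E') x),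
        lmConnection g nabla J eta l m Y x u =
          nabla Y x u + g.inner x (Y x) (eta x) • (l x • u + m x • J x u) := by
      intro Y u
      rw [g.symm x (Y x)]
      rfl
    simp only [key, FiberBundle.extend_apply_self] at h0 ⊢
    rw [sub_eq_zero] at h0
    rw [← h0]
    module

end Ambient

/-! ## Objects along a map -/

section Along

variable {E : Type*} [NormedAddCommGroup E] [NormedSpace ℝ E] [FiniteDimensional ℝ E]
  {M : Type*} [TopologicalSpace M] [ChartedSpace E M] [IsManifold 𝓘(ℝ, E) ∞ M]
  {E' : Type*} [NormedAddCommGroup E'] [NormedSpace ℝ E'] [FiniteDimensional ℝ E']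
  {N : Type*} [TopologicalSpace N] [ChartedSpace E' N] [IsManifold 𝓘(ℝ, E') ∞ N]

variable (E) in
/-- A field `D` of subspaces `D x ⊆ T_{f x} N` is a smooth vector subbundle of the restriction
`TN|_M = f^* TN`: near each point it has a smooth local frame. -/
def IsSmoothSubbundle (f : M → N) (D : Π x : M, Submodule ℝ (TangentSpace 𝓘(ℝ, E') (f x))) :
    Prop :=
  ∀ x₀ : M, ∃ U : Set M, IsOpen U ∧ x₀ ∈ U ∧ ∃ (k : ℕ)
    (s : Fin k → Π x : M, TangentSpace 𝓘(ℝ, E') (f x)),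
    (∀ i, ContMDiffOn 𝓘(ℝ, E) 𝓘(ℝ, E').tangent ∞
      (fun x ↦ (⟨f x, s i x⟩ : TangentBundle 𝓘(ℝ, E') N)) U) ∧
    ∀ x ∈ U, LinearIndependent ℝ (fun i ↦ s i x) ∧
      Submodule.span ℝ (Set.range fun i ↦ s i x) = D x

/-- The vector field `x ↦ df_x (X x)` along `f` determined by a vector field `X` on `M`. -/
def pushforward (f : M → N) (X : Π x : M, TangentSpace 𝓘(ℝ, E) x) (x : M) :
    TangentSpace 𝓘(ℝ, E') (f x) :=
  mfderiv 𝓘(ℝ, E) 𝓘(ℝ, E') f x (X x)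

/-- The covariant derivative `Ω_v V`, for `v ∈ T_x M`, of a field `V` along `f : M → N`
(that is, of a section of `f^* TN`) with respect to a connection `Omega` on `N`.
In the trivialization `e` of `TN` around `f x`, write `V = e⁻¹ ∘ w`. Then
`Ω_v V = e⁻¹ (dw (v)) + Ω_{df v} (V x)~`, where `(V x)~` is the local vector field on `N` which is
constant in the trivialization `e` and takes the value `V x` at `f x`. -/
def covAlong (Omega : CovariantDerivative 𝓘(ℝ, E') E' (TangentSpace 𝓘(ℝ, E') : N → Type _))
    (f : M → N) (V : Π x : M, TangentSpace 𝓘(ℝ, E') (f x)) (x : M) (v : TangentSpace 𝓘(ℝ, E) x) :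
    TangentSpace 𝓘(ℝ, E') (f x) :=
  let e := trivializationAt E' (TangentSpace 𝓘(ℝ, E') : N → Type _) (f x)
  e.symm (f x) (mvfderiv 𝓘(ℝ, E) (fun y ↦ (e ⟨f y, V y⟩).2) x v) +
    Omega (FiberBundle.extend E' (x := f x) (V x)) (f x) (mfderiv 𝓘(ℝ, E) 𝓘(ℝ, E') f x v)

end Along

/-! ## Linear algebra of the lightlike decomposition -/

section LinearAlgebra

variable {V : Type*} [AddCommGroup V] [Module ℝ V] [FiniteDimensional ℝ V]

/-- If `T = R ⊕ S` and `Tᗮ = R ⊕ W` with `R = T ∩ Tᗮ`, and `(S + W)ᗮ = R ⊕ L`, then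
`V = T ⊕ L ⊕ W`. -/
theorem lightlike_decomposition (b : LinearMap.BilinForm ℝ V) (hs : ∀ v w, b v w = b w v)
    (hn : ∀ v, (∀ w, b v w = 0) → v = 0) (T S W L : Submodule ℝ V)
    (hS : Disjoint (T ⊓ b.orthogonal T) S) (hS' : (T ⊓ b.orthogonal T) ⊔ S = T)
    (hW : Disjoint (T ⊓ b.orthogonal T) W) (hW' : (T ⊓ b.orthogonal T) ⊔ W = b.orthogonal T)
    (hL : Disjoint (T ⊓ b.orthogonal T) L)
    (hL' : (T ⊓ b.orthogonal T) ⊔ L = b.orthogonal (S ⊔ W)) :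
    IsCompl T (L ⊔ W) ∧ IsCompl L (T ⊔ W) ∧ IsCompl W (T ⊔ L) := by
  have hrefl : b.IsRefl := fun v w h ↦ by rw [hs]; exact h
  have hnd : b.Nondegenerate := ⟨hn, fun v h ↦ hn v fun w ↦ by rw [hs]; exact h w⟩
  have hoo : b.orthogonal (b.orthogonal T) = T :=
    LinearMap.BilinForm.orthogonal_orthogonal hnd hrefl T
  have hST : S ≤ T := hS' ▸ le_sup_right
  have hWT : W ≤ b.orthogonal T := hW' ▸ le_sup_right
  -- `S` and `W` are nondegenerate and mutually orthogonal
  have hSnd : ∀ v ∈ S, (∀ w ∈ S, b w v = 0) → v = 0 := by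
    intro v hv h
    refine Submodule.disjoint_def.1 hS v ⟨hST hv, ?_⟩ hv
    intro t ht
    rw [← hS'] at ht
    obtain ⟨a, ha, c, hc, rfl⟩ := Submodule.mem_sup.1 ht
    have h1 : b a v = 0 := by rw [hs]; exact ha.2 v (hST hv)
    change b (a + c) v = 0
    rw [map_add, LinearMap.add_apply, h1, h c hc, add_zero]
  have hWnd : ∀ v ∈ W, (∀ w ∈ W, b w v = 0) → v = 0 := by
    intro v hv h
    refine Submodule.disjoint_def.1 hW v ⟨?_, hWT hv⟩ hv
    rw [← hoo]
    intro t ht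
    rw [← hW'] at ht
    obtain ⟨a, ha, c, hc, rfl⟩ := Submodule.mem_sup.1 ht
    have h1 : b a v = 0 := hWT hv a ha.1
    change b (a + c) v = 0
    rw [map_add, LinearMap.add_apply, h1, h c hc, add_zero]
  have hSW : ∀ u ∈ S, ∀ w ∈ W, b u w = 0 := fun u hu w hw ↦ hWT hw u (hST hu)
  have hdisj : ∀ u ∈ S, ∀ w ∈ W, u + w ∈ b.orthogonal (S ⊔ W) → u = 0 ∧ w = 0 := by
    intro u hu w hw h
    constructor
    · refine hSnd u hu fun s hs' ↦ ?_
      have h1 : b s (u + w) = 0 := h s (Submodule.mem_sup_left hs')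
      rwa [map_add, hSW s hs' w hw, add_zero] at h1
    · refine hWnd w hw fun s hs' ↦ ?_
      have h1 : b s (u + w) = 0 := h s (Submodule.mem_sup_right hs')
      rwa [map_add, hs s u, hSW u hu s hs', zero_add] at h1
  have hcompl : IsCompl (S ⊔ W) (b.orthogonal (S ⊔ W)) := by
    refine (LinearMap.BilinForm.isCompl_orthogonal_iff_disjoint hrefl).2 ?_
    rw [Submodule.disjoint_def]
    intro v hv hv'
    obtain ⟨u, hu, w, hw, rfl⟩ := Submodule.mem_sup.1 hv
    obtain ⟨rfl, rfl⟩ := hdisj u hu w hw hv'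
    simp
  -- the sum of the four pieces is direct
  have hind : ∀ t ∈ T, ∀ n ∈ L, ∀ w ∈ W, t + n + w = 0 → t = 0 ∧ n = 0 ∧ w = 0 := by
    intro t ht n hn' w hw h
    rw [← hS'] at ht
    obtain ⟨a, ha, c, hc, rfl⟩ := Submodule.mem_sup.1 ht
    have han : a + n ∈ b.orthogonal (S ⊔ W) := by
      rw [← hL']; exact Submodule.add_mem_sup ha hn'
    have hcw : c + w = -(a + n) := by
      rw [eq_neg_iff_add_eq_zero, ← h]; abel
    obtain ⟨rfl, rfl⟩ := hdisj c hc w hw (hcw ▸ neg_mem han)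
    have h2 : a + n = 0 := by simpa using h
    have h3 : n = -a := by rw [eq_neg_iff_add_eq_zero, ← h2]; abel
    have h4 : n = 0 := Submodule.disjoint_def.1 hL n (h3 ▸ neg_mem ha) hn'
    subst h4
    exact ⟨by simpa using h2, rfl, rfl⟩
  have htop : T ⊔ L ⊔ W = ⊤ := by
    rw [eq_top_iff, ← hcompl.sup_eq_top, ← hL']
    refine sup_le (sup_le ?_ le_sup_right) (sup_le ?_ ?_)
    · exact hST.trans (le_sup_left.trans le_sup_left)
    · exact inf_le_left.trans (le_sup_left.trans le_sup_left)
    · exact le_sup_right.trans le_sup_left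
  refine ⟨⟨?_, ?_⟩, ⟨?_, ?_⟩, ⟨?_, ?_⟩⟩
  · rw [Submodule.disjoint_def]
    intro v hv hv'
    obtain ⟨n, hn', w, hw, rfl⟩ := Submodule.mem_sup.1 hv'
    obtain ⟨-, h2, h3⟩ := hind (n + w) hv (-n) (neg_mem hn') (-w) (neg_mem hw) (by abel)
    rw [neg_eq_zero.1 h2, neg_eq_zero.1 h3, add_zero]
  · rw [codisjoint_iff, ← sup_assoc, htop]
  · rw [Submodule.disjoint_def]
    intro v hv hv'
    obtain ⟨t, ht, w, hw, rfl⟩ := Submodule.mem_sup.1 hv'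
    obtain ⟨h1, -, h3⟩ := hind (-t) (neg_mem ht) (t + w) hv (-w) (neg_mem hw) (by abel)
    rw [neg_eq_zero.1 h1, neg_eq_zero.1 h3, add_zero]
  · rw [codisjoint_iff, ← htop]
    ac_rfl
  · rw [Submodule.disjoint_def]
    intro v hv hv'
    obtain ⟨t, ht, n, hn', rfl⟩ := Submodule.mem_sup.1 hv'
    obtain ⟨h1, h2, -⟩ := hind (-t) (neg_mem ht) (-n) (neg_mem hn') (t + n) hv (by abel)
    rw [neg_eq_zero.1 h1, neg_eq_zero.1 h2, add_zero]
  · rw [codisjoint_iff, ← htop]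
    ac_rfl

end LinearAlgebra

/-! ## Lightlike submanifolds -/

variable {E : Type*} [NormedAddCommGroup E] [NormedSpace ℝ E] [FiniteDimensional ℝ E]
  {M : Type*} [TopologicalSpace M] [ChartedSpace E M] [IsManifold 𝓘(ℝ, E) ∞ M]
  {E' : Type*} [NormedAddCommGroup E'] [NormedSpace ℝ E'] [FiniteDimensional ℝ E']
  {N : Type*} [TopologicalSpace N] [ChartedSpace E' N] [IsManifold 𝓘(ℝ, E') ∞ N]

variable (E) in
/-- The tangent space `TM_x`, as the subspace `df_x (T_x M)` of `T_{f x} N`. -/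
def tangent (f : M → N) (x : M) : Submodule ℝ (TangentSpace 𝓘(ℝ, E') (f x)) :=
  LinearMap.range (mfderiv 𝓘(ℝ, E) 𝓘(ℝ, E') f x).toLinearMap

variable (E) in
/-- The normal space `TM_x^⊥` in `T_{f x} N`. -/
def normal (g : SemiRiemannianMetric E' N) (f : M → N) (x : M) :
    Submodule ℝ (TangentSpace 𝓘(ℝ, E') (f x)) :=
  (g.bilin (f x)).orthogonal (tangent E f x)

variable (E) in
/-- The radical `Rad(TM)_x = TM_x ∩ TM_x^⊥`. -/
def rad (g : SemiRiemannianMetric E' N) (f : M → N) (x : M) :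
    Submodule ℝ (TangentSpace 𝓘(ℝ, E') (f x)) :=
  tangent E f x ⊓ normal E g f x

variable (E) in
/-- A lightlike submanifold `(M, g, S(TM), S(TM^⊥))`, immersed in `(N, g)` by `f`, together with
a lightlike transversal bundle `ltr(TM)`. All bundles are smooth subbundles of `TN|_M`. -/
structure LightlikeSubmanifold (g : SemiRiemannianMetric E' N) (f : M → N) where
  contMDiff : ContMDiff 𝓘(ℝ, E) 𝓘(ℝ, E') ∞ f
  injective_mfderiv : ∀ x, Function.Injective (mfderiv 𝓘(ℝ, E) 𝓘(ℝ, E') f x)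
  /-- the rank of the radical distribution -/
  r : ℕ
  r_pos : 0 < r
  finrank_rad : ∀ x, Module.finrank ℝ (rad E g f x) = r
  rad_smooth : IsSmoothSubbundle E f (rad E g f)
  /-- the screen distribution `S(TM)`, with `TM = Rad(TM) ⊥ S(TM)` -/
  screen : Π x : M, Submodule ℝ (TangentSpace 𝓘(ℝ, E') (f x))
  screen_smooth : IsSmoothSubbundle E f screen
  disjoint_screen : ∀ x, Disjoint (rad E g f x) (screen x)
  rad_sup_screen : ∀ x, rad E g f x ⊔ screen x = tangent E f x
  /-- the screen transversal bundle `S(TM^⊥)`, with `TM^⊥ = Rad(TM) ⊥ S(TM^⊥)` -/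
  screenTransversal : Π x : M, Submodule ℝ (TangentSpace 𝓘(ℝ, E') (f x))
  screenTransversal_smooth : IsSmoothSubbundle E f screenTransversal
  disjoint_screenTransversal : ∀ x, Disjoint (rad E g f x) (screenTransversal x)
  rad_sup_screenTransversal : ∀ x, rad E g f x ⊔ screenTransversal x = normal E g f x
  /-- the lightlike transversal bundle `ltr(TM)`: a null complement of `Rad(TM)` in the orthogonal
  complement of `S(TM) ⊥ S(TM^⊥)` -/
  ltr : Π x : M, Submodule ℝ (TangentSpace 𝓘(ℝ, E') (f x))
  ltr_smooth : IsSmoothSubbundle E f ltr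
  ltr_null : ∀ x, ∀ v ∈ ltr x, ∀ w ∈ ltr x, g.inner (f x) v w = 0
  disjoint_ltr : ∀ x, Disjoint (rad E g f x) (ltr x)
  rad_sup_ltr : ∀ x, rad E g f x ⊔ ltr x =
    (g.bilin (f x)).orthogonal (screen x ⊔ screenTransversal x)

namespace LightlikeSubmanifold

variable {g : SemiRiemannianMetric E' N} {f : M → N} (L : LightlikeSubmanifold E g f)

/-- `TN|_M = TM ⊕ ltr(TM) ⊕ S(TM^⊥)`. -/
theorem decomposition (x : M) :
    IsCompl (tangent E f x) (L.ltr x ⊔ L.screenTransversal x) ∧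
      IsCompl (L.ltr x) (tangent E f x ⊔ L.screenTransversal x) ∧
      IsCompl (L.screenTransversal x) (tangent E f x ⊔ L.ltr x) :=
  haveI : FiniteDimensional ℝ (TangentSpace 𝓘(ℝ, E') (f x)) :=
    inferInstanceAs (FiniteDimensional ℝ E')
  lightlike_decomposition (g.bilin (f x)) (g.symm (f x)) (g.nondegenerate (f x)) _ _ _ _
    (L.disjoint_screen x) (L.rad_sup_screen x) (L.disjoint_screenTransversal x)
    (L.rad_sup_screenTransversal x) (L.disjoint_ltr x) (L.rad_sup_ltr x)

section Gauss

/-! The Gauss formula `Ω̄_X Y = Ω_X Y + h^l(X,Y) + h^s(X,Y)`, according to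
`TN|_M = TM ⊕ ltr(TM) ⊕ S(TM^⊥)`. -/

variable (Omega : CovariantDerivative 𝓘(ℝ, E') E' (TangentSpace 𝓘(ℝ, E') : N → Type _))
  (X Y : Π x : M, TangentSpace 𝓘(ℝ, E) x)

/-- `Ω̄_X Y`, for vector fields `X, Y` on `M`, a field along `f`. -/
def ambientDeriv (f : M → N) (x : M) : TangentSpace 𝓘(ℝ, E') (f x) :=
  covAlong Omega f (pushforward f Y) x (X x)

/-- The induced connection `Ω_X Y`: the vector field on `M` that `df` maps to the `TM`-component
of `Ω̄_X Y`. -/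
def inducedConnection (x : M) : TangentSpace 𝓘(ℝ, E) x :=
  (LinearEquiv.ofInjective (mfderiv 𝓘(ℝ, E) 𝓘(ℝ, E') f x).toLinearMap
    (L.injective_mfderiv x)).symm
    (Submodule.projectionOnto (tangent E f x) (L.ltr x ⊔ L.screenTransversal x)
      (L.decomposition x).1 (ambientDeriv Omega X Y f x))

/-- The lightlike second fundamental form `h^l(X, Y)`: the `ltr(TM)`-component of `Ω̄_X Y`. -/
def hl (x : M) : TangentSpace 𝓘(ℝ, E') (f x) :=
  Submodule.projection (L.ltr x) (tangent E f x ⊔ L.screenTransversal x)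
    (L.decomposition x).2.1 (ambientDeriv Omega X Y f x)

/-- The screen second fundamental form `h^s(X, Y)`: the `S(TM^⊥)`-component of `Ω̄_X Y`. -/
def hs (x : M) : TangentSpace 𝓘(ℝ, E') (f x) :=
  Submodule.projection (L.screenTransversal x) (tangent E f x ⊔ L.ltr x)
    (L.decomposition x).2.2 (ambientDeriv Omega X Y f x)

end Gauss

/-! ### Screen generic lightlike submanifolds -/

variable (J : Π x : N, TangentSpace 𝓘(ℝ, E') x →L[ℝ] TangentSpace 𝓘(ℝ, E') x)

/-- `B_o = J(S(TM)) ∩ S(TM)`. -/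
def Bo (x : M) : Submodule ℝ (TangentSpace 𝓘(ℝ, E') (f x)) :=
  (L.screen x).map (J (f x)).toLinearMap ⊓ L.screen x

/-- `B = B_o ⊥ Rad(TM)`. -/
def B (x : M) : Submodule ℝ (TangentSpace 𝓘(ℝ, E') (f x)) :=
  L.Bo J x ⊔ rad E g f x

/-- `M` is screen generic: `J(Rad TM) = Rad TM`, and `B_o = J(S(TM)) ∩ S(TM)` is a nondegenerate
smooth distribution. -/
structure IsScreenGeneric : Prop where
  map_rad : ∀ x, (rad E g f x).map (J (f x)).toLinearMap = rad E g f x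
  Bo_smooth : IsSmoothSubbundle E f (L.Bo J)
  Bo_nondegenerate : ∀ x, ∀ v ∈ L.Bo J x, (∀ w ∈ L.Bo J x, g.inner (f x) v w = 0) → v = 0

end LightlikeSubmanifold

/-! ### Distributions on `M` -/

/-- `X ∈ Γ(D)`: the smooth vector field `X` on `M` is a section of the distribution `D ⊆ TM`. -/
def IsSection (f : M → N) (D : Π x : M, Submodule ℝ (TangentSpace 𝓘(ℝ, E') (f x)))
    (X : Π x : M, TangentSpace 𝓘(ℝ, E) x) : Prop :=
  ContMDiff 𝓘(ℝ, E) 𝓘(ℝ, E).tangent ∞ (fun x ↦ (⟨x, X x⟩ : TangentBundle 𝓘(ℝ, E) M)) ∧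
    ∀ x, pushforward f X x ∈ D x

variable (E) in
/-- `D` is integrable: `[X, Y] ∈ Γ(D)` for all `X, Y ∈ Γ(D)`. -/
def IsIntegrable (f : M → N) (D : Π x : M, Submodule ℝ (TangentSpace 𝓘(ℝ, E') (f x))) : Prop :=
  ∀ X Y : Π x : M, TangentSpace 𝓘(ℝ, E) x, IsSection f D X → IsSection f D Y →
    ∀ x, pushforward f (VectorField.mlieBracket 𝓘(ℝ, E) X Y) x ∈ D x

variable (E) in
/-- `D` defines a totally geodesic foliation in `N` with respect to `Omega`: `D` is integrable and
`Ω̄_X Y ∈ Γ(D)` for all `X, Y ∈ Γ(D)`. -/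
def DefinesTotallyGeodesicFoliation
    (Omega : CovariantDerivative 𝓘(ℝ, E') E' (TangentSpace 𝓘(ℝ, E') : N → Type _))
    (f : M → N) (D : Π x : M, Submodule ℝ (TangentSpace 𝓘(ℝ, E') (f x))) : Prop :=
  IsIntegrable E f D ∧
  ∀ X Y : Π x : M, TangentSpace 𝓘(ℝ, E) x, IsSection f D X → IsSection f D Y →
    ∀ x, LightlikeSubmanifold.ambientDeriv Omega X Y f x ∈ D x

namespace LightlikeSubmanifold

variable {g : SemiRiemannianMetric E' N} {f : M → N} (L : LightlikeSubmanifold E g f)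
  (Omega : CovariantDerivative 𝓘(ℝ, E') E' (TangentSpace 𝓘(ℝ, E') : N → Type _))
  (D : Π x : M, Submodule ℝ (TangentSpace 𝓘(ℝ, E') (f x)))

/-- `M` is `D`-geodesic: `h^l(X,Y) = h^s(X,Y) = 0` for all `X, Y ∈ Γ(D)`. -/
def IsGeodesicOn : Prop :=
  ∀ X Y : Π x : M, TangentSpace 𝓘(ℝ, E) x, IsSection f D X → IsSection f D Y →
    ∀ x, L.hl Omega X Y x = 0 ∧ L.hs Omega X Y x = 0

/-- `D` is parallel with respect to the induced connection: `Ω_X Y ∈ Γ(D)` for all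
`X, Y ∈ Γ(D)`. -/
def IsParallel : Prop :=
  ∀ X Y : Π x : M, TangentSpace 𝓘(ℝ, E) x, IsSection f D X → IsSection f D Y →
    ∀ x, pushforward f (L.inducedConnection Omega X Y) x ∈ D x

end LightlikeSubmanifold

end LightlikeGeometry

end

/-! At each point `B` lies in `TM`, so in the splitting `TM ⊕ ltr(TM) ⊕ S(TM^⊥)` the vector `Ω̄_X Y`
lies in `B` exactly when its two transversal components vanish and its tangential component lies in
`B` (`ambientDeriv_mem_iff`). This settles everything except integrability.

Integrability then follows from closure of `B` under `Ω̄`: `df [X, Y] = Ω̄_X Y - Ω̄_Y X - T̄(X, Y)`,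
and the torsion is a combination of `X`, `Y`, `JX`, `JY`. It remains to see that `B` is
`J`-invariant, which the bronze relation gives on `B_o` (`map_mem_B`).

The analytic work is the torsion identity for a connection along an immersion
(`covAlong_pushforward_sub`). In a chart `φ` of `N`, the field `df Y` reads as the derivative of `φ
∘ f` along `Y`, so the identity reduces to `X(YF) - Y(XF) = [X, Y]F` for vector-valued `F`
(`mvfderiv_mfderiv_sub`) and to the vanishing bracket of fields constant in a trivialization
(`mlieBracket_extend`). -/

noncomputable section

namespace LightlikeGeometry

open Filter VectorField Topology

/-! ### Lie brackets and second derivatives of vector-valued functions. -/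

section VectorValued

variable {E : Type*} [NormedAddCommGroup E] [NormedSpace ℝ E] [FiniteDimensional ℝ E]
  {M : Type*} [TopologicalSpace M] [ChartedSpace E M] [IsManifold 𝓘(ℝ, E) ∞ M]
  {F : Type*} [NormedAddCommGroup F] [NormedSpace ℝ F]

/-- The representative of a vector field in the chart at `x`. -/
def chartRepr (x : M) (X : Π x : M, TangentSpace 𝓘(ℝ, E) x) : E → E :=
  mpullbackWithin 𝓘(ℝ, E) 𝓘(ℝ, E) (extChartAt 𝓘(ℝ, E) x).symm X (range 𝓘(ℝ, E))

omit [FiniteDimensional ℝ E] in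
theorem chartRepr_extChartAt (x : M) (X : Π x : M, TangentSpace 𝓘(ℝ, E) x) {y : M}
    (hy : y ∈ (extChartAt 𝓘(ℝ, E) x).source) :
    chartRepr x X (extChartAt 𝓘(ℝ, E) x y) =
      mfderiv 𝓘(ℝ, E) 𝓘(ℝ, E) (extChartAt 𝓘(ℝ, E) x) y (X y) := by
  have : IsManifold 𝓘(ℝ, E) 1 M := .of_le (n := ∞) (by simp)
  have h1 := mfderivWithin_extChartAt_symm_comp_mfderiv_extChartAt' hy
  have h2 := mfderiv_extChartAt_comp_mfderivWithin_extChartAt_symm' hy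
  have hl := (extChartAt 𝓘(ℝ, E) x).left_inv hy
  rw [chartRepr, mpullbackWithin_apply]
  -- The round trip through the chart returns `y` only propositionally, while `X` takes values in
  -- dependent fibres; the point is generalized so that it can be substituted.
  generalize hz : (extChartAt 𝓘(ℝ, E) x).symm (extChartAt 𝓘(ℝ, E) x y) = z at *
  subst hl
  rw [ContinuousLinearMap.inverse_eq h1 h2]

theorem differentiableAt_chartRepr {x : M} {X : Π x : M, TangentSpace 𝓘(ℝ, E) x}
    (hX : MDifferentiableAt 𝓘(ℝ, E) 𝓘(ℝ, E).tangent
      (fun y ↦ (⟨y, X y⟩ : TangentBundle 𝓘(ℝ, E) M)) x) :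
    DifferentiableAt ℝ (chartRepr x X) (extChartAt 𝓘(ℝ, E) x x) := by
  have : IsManifold 𝓘(ℝ, E) 2 M := .of_le (n := ∞) ENat.LEInfty.out
  have : DifferentiableWithinAt ℝ (chartRepr x X) _ _ :=
    (mdifferentiableWithinAt_univ.2 hX).differentiableWithinAt_mpullbackWithin_vectorField
  refine DifferentiableWithinAt.differentiableAt (s := univ) ?_ univ_mem
  simpa using this

-- The manifold bracket at `x` is defined as the bracket of the chart representatives pulled back by
-- the derivative of the chart, an invertible map; applying that derivative cancels the pullback.
omit [FiniteDimensional ℝ E] in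
theorem mfderiv_extChartAt_mlieBracket (X Y : Π x : M, TangentSpace 𝓘(ℝ, E) x) (x : M) :
    mfderiv 𝓘(ℝ, E) 𝓘(ℝ, E) (extChartAt 𝓘(ℝ, E) x) x (mlieBracket 𝓘(ℝ, E) X Y x) =
      lieBracket ℝ (chartRepr x X) (chartRepr x Y) (extChartAt 𝓘(ℝ, E) x x) := by
  have : IsManifold 𝓘(ℝ, E) 1 M := .of_le (n := ∞) (by simp)
  have h := isInvertible_mfderiv_extChartAt (I := 𝓘(ℝ, E)) (mem_extChartAt_source (I := 𝓘(ℝ, E)) x)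
  rw [← mlieBracketWithin_univ, mlieBracketWithin_apply]
  refine (h.self_apply_inverse _).trans ?_
  change lieBracketWithin ℝ (chartRepr x X) (chartRepr x Y) _ _ = _
  simp

/-- Differentiating a vector valued function twice:
`X (Y F) - Y (X F) = [X, Y] F`. -/
theorem mvfderiv_mfderiv_sub {F₀ : M → F} {x : M} (hF : ContMDiffAt 𝓘(ℝ, E) 𝓘(ℝ, F) 2 F₀ x)
    {X Y : Π x : M, TangentSpace 𝓘(ℝ, E) x}
    (hX : MDifferentiableAt 𝓘(ℝ, E) 𝓘(ℝ, E).tangent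
      (fun y ↦ (⟨y, X y⟩ : TangentBundle 𝓘(ℝ, E) M)) x)
    (hY : MDifferentiableAt 𝓘(ℝ, E) 𝓘(ℝ, E).tangent
      (fun y ↦ (⟨y, Y y⟩ : TangentBundle 𝓘(ℝ, E) M)) x) :
    mvfderiv 𝓘(ℝ, E) (fun y ↦ mvfderiv 𝓘(ℝ, E) F₀ y (Y y)) x (X x) -
      mvfderiv 𝓘(ℝ, E) (fun y ↦ mvfderiv 𝓘(ℝ, E) F₀ y (X y)) x (Y x) =
    mvfderiv 𝓘(ℝ, E) F₀ x (mlieBracket 𝓘(ℝ, E) X Y x) := by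
  have : IsManifold 𝓘(ℝ, E) 1 M := .of_le (n := ∞) (by simp)
  set ψ := extChartAt 𝓘(ℝ, E) x with hψ
  set G : E → F := F₀ ∘ ψ.symm with hG
  have hGc : ContDiffAt ℝ 2 G (ψ x) := by
    have := (contMDiffAt_iff.1 hF).2
    rwa [extChartAt_model_space_eq_id, show range 𝓘(ℝ, E) = univ by simp,
      contDiffWithinAt_univ] at this
  have hGd : ∀ᶠ z in 𝓝 (ψ x), DifferentiableAt ℝ G z := by
    filter_upwards [hGc.eventually (by simp)] with z hz using hz.differentiableAt (by simp)
  have hψd : ∀ y ∈ ψ.source, MDifferentiableAt 𝓘(ℝ, E) 𝓘(ℝ, E) ψ y := fun y hy ↦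
    mdifferentiableAt_extChartAt (by simpa [hψ] using hy)
  have hcomp : ∀ (H : E → F) (y : M), y ∈ ψ.source → DifferentiableAt ℝ H (ψ y) →
      ∀ (K : M → F), K =ᶠ[𝓝 y] H ∘ ψ → ∀ v, mvfderiv 𝓘(ℝ, E) K y v =
        fderiv ℝ H (ψ y) (mfderiv 𝓘(ℝ, E) 𝓘(ℝ, E) ψ y v) := by
    intro H y hy hH K hK v
    have h1 : HasMFDerivAt 𝓘(ℝ, E) 𝓘(ℝ, F) K y
        ((fderiv ℝ H (ψ y)).comp (mfderiv 𝓘(ℝ, E) 𝓘(ℝ, E) ψ y)) :=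
      (hH.hasFDerivAt.hasMFDerivAt.comp y (hψd y hy).hasMFDerivAt).congr_of_eventuallyEq hK
    change mfderiv 𝓘(ℝ, E) 𝓘(ℝ, F) K y v = _
    rw [h1.mfderiv]
    rfl
  have hsrc : ψ.source ∈ 𝓝 x := extChartAt_source_mem_nhds x
  have hx : x ∈ ψ.source := mem_extChartAt_source x
  have hFG : ∀ y ∈ ψ.source, F₀ =ᶠ[𝓝 y] G ∘ ψ := by
    intro y hy
    filter_upwards [(isOpen_extChartAt_source x).mem_nhds hy] with z hz
    simp only [hG, Function.comp_apply, ψ.left_inv hz]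
  -- Equality at `x` alone would not suffice: both sides are differentiated once more, so they must
  -- agree near `x`.
  have hfield : ∀ Z : Π x : M, TangentSpace 𝓘(ℝ, E) x,
      (fun y ↦ mvfderiv 𝓘(ℝ, E) F₀ y (Z y)) =ᶠ[𝓝 x]
        (fun z ↦ fderiv ℝ G z (chartRepr x Z z)) ∘ ψ := by
    intro Z
    filter_upwards [hsrc, (continuousAt_extChartAt x).eventually hGd] with y hy hGy
    rw [hcomp G y hy hGy F₀ (hFG y hy), Function.comp_apply, chartRepr_extChartAt x Z hy]
  have hG' : DifferentiableAt ℝ (fderiv ℝ G) (ψ x) :=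
    (hGc.fderiv_right (m := 1) (by norm_num)).differentiableAt (by simp)
  -- Product rule in the chart: `W(ZF) = D²G(W, Z) + DG(DZ(W))`.
  have hsnd : ∀ Z W : Π x : M, TangentSpace 𝓘(ℝ, E) x,
      MDifferentiableAt 𝓘(ℝ, E) 𝓘(ℝ, E).tangent
        (fun y ↦ (⟨y, Z y⟩ : TangentBundle 𝓘(ℝ, E) M)) x →
      mvfderiv 𝓘(ℝ, E) (fun y ↦ mvfderiv 𝓘(ℝ, E) F₀ y (Z y)) x (W x) =
        fderiv ℝ (fderiv ℝ G) (ψ x) (chartRepr x W (ψ x)) (chartRepr x Z (ψ x)) +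
          fderiv ℝ G (ψ x) (fderiv ℝ (chartRepr x Z) (ψ x) (chartRepr x W (ψ x))) := by
    intro Z W hZ
    have hZ' := differentiableAt_chartRepr hZ
    have hd := hG'.hasFDerivAt.clm_apply hZ'.hasFDerivAt
    rw [hcomp _ x hx hd.differentiableAt _ (hfield Z), hd.fderiv, ← chartRepr_extChartAt x W hx]
    exact add_comm _ _
  -- The `D²G` terms cancel by symmetry; what remains is `DG` applied to `DY(X) - DX(Y)`, the
  -- bracket in coordinates.
  rw [hsnd Y X hY, hsnd X Y hX, hcomp G x hx hGd.self_of_nhds F₀ (hFG x hx),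
    mfderiv_extChartAt_mlieBracket, lieBracket_eq, map_sub,
    (hGc.isSymmSndFDerivAt (by simp)).eq]
  abel

end VectorValued

/-! ### Torsion of a connection along a map. -/

section AmbientTorsion

theorem mvfderiv_congr {E : Type*} [NormedAddCommGroup E] [NormedSpace ℝ E]
    {M : Type*} [TopologicalSpace M] [ChartedSpace E M]
    {F : Type*} [NormedAddCommGroup F] [NormedSpace ℝ F] {K H : M → F} {x : M}
    (h : K =ᶠ[𝓝 x] H) : mvfderiv 𝓘(ℝ, E) K x = mvfderiv 𝓘(ℝ, E) H x := by
  ext v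
  change (mfderiv 𝓘(ℝ, E) 𝓘(ℝ, F) K x v : F) = mfderiv 𝓘(ℝ, E) 𝓘(ℝ, F) H x v
  rw [h.mfderiv_eq]
  rfl

variable {E' : Type*} [NormedAddCommGroup E'] [NormedSpace ℝ E'] [FiniteDimensional ℝ E']
  {N : Type*} [TopologicalSpace N] [ChartedSpace E' N] [IsManifold 𝓘(ℝ, E') ∞ N]

-- The tangent bundle is trivialized by derivatives of charts. This turns fibre components of a
-- field along a map into derivatives of a vector-valued function.
omit [FiniteDimensional ℝ E'] in
theorem trivializationAt_apply_snd {p q : N} (hq : q ∈ (extChartAt 𝓘(ℝ, E') p).source)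
    (v : TangentSpace 𝓘(ℝ, E') q) :
    (trivializationAt E' (TangentSpace 𝓘(ℝ, E') : N → Type _) p ⟨q, v⟩).2 =
      mvfderiv 𝓘(ℝ, E') (extChartAt 𝓘(ℝ, E') p) q v := by
  have : IsManifold 𝓘(ℝ, E') 1 N := .of_le (n := ∞) (by simp)
  have hq' : q ∈ (chartAt E' p).source := by simpa using hq
  have h := DFunLike.congr_fun (TangentBundle.continuousLinearMapAt_trivializationAt
    (I := 𝓘(ℝ, E')) hq') v
  change _ = mfderiv 𝓘(ℝ, E') 𝓘(ℝ, E') (extChartAt 𝓘(ℝ, E') p) q v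
  refine Eq.trans ?_ h
  rw [Trivialization.continuousLinearMapAt_apply, Trivialization.linearMapAt_apply,
    if_pos (by simpa using hq')]

/-- Fields which are constant in a trivialization of the tangent bundle commute. -/
theorem mlieBracket_extend (p : N) (v w : TangentSpace 𝓘(ℝ, E') p) :
    mlieBracket 𝓘(ℝ, E') (FiberBundle.extend E' v) (FiberBundle.extend E' w) p = 0 := by
  have : IsManifold 𝓘(ℝ, E') 1 N := .of_le (n := ∞) (by simp)
  have : IsManifold 𝓘(ℝ, E') (1 + 1) N :=
    .of_le (n := ∞) (by rw [one_add_one_eq_two]; exact ENat.LEInfty.out)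
  have hconst : ∀ u : TangentSpace 𝓘(ℝ, E') p,
      (fun q ↦ mvfderiv 𝓘(ℝ, E') (extChartAt 𝓘(ℝ, E') p) q (FiberBundle.extend E' u q)) =ᶠ[𝓝 p]
        fun _ ↦ (trivializationAt E' (TangentSpace 𝓘(ℝ, E') : N → Type _) p ⟨p, u⟩).2 := by
    intro u
    filter_upwards [extChartAt_source_mem_nhds (I := 𝓘(ℝ, E')) p] with q hq
    rw [← trivializationAt_apply_snd hq]
    have hq' : q ∈ (trivializationAt E' (TangentSpace 𝓘(ℝ, E') : N → Type _) p).baseSet := by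
      simpa using hq
    have h := congrArg Prod.snd (Trivialization.apply_mk_symm _ hq'
      (trivializationAt E' (TangentSpace 𝓘(ℝ, E') : N → Type _) p ⟨p, u⟩).2)
    exact h
  have hzero : ∀ u u' : TangentSpace 𝓘(ℝ, E') p,
      mvfderiv 𝓘(ℝ, E') (fun q ↦ mvfderiv 𝓘(ℝ, E') (extChartAt 𝓘(ℝ, E') p) q
        (FiberBundle.extend E' u q)) p u' = 0 := by
    intro u u'
    rw [mvfderiv_congr (hconst u)]
    change mfderiv 𝓘(ℝ, E') 𝓘(ℝ, E') (fun _ ↦ _) p u' = _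
    rw [mfderiv_const]
    rfl
  -- Take the chart itself as the function: both fields have constant derivatives of it near `p`, so
  -- the second-order terms vanish, and its derivative at `p` is injective.
  have key := mvfderiv_mfderiv_sub (F₀ := extChartAt 𝓘(ℝ, E') p) (x := p)
    ((contMDiffAt_extChartAt (n := ∞)).of_le ENat.LEInfty.out)
    (FiberBundle.mdifferentiableAt_extend (I := 𝓘(ℝ, E')) (F := E') v)
    (FiberBundle.mdifferentiableAt_extend (I := 𝓘(ℝ, E')) (F := E') w)
  rw [hzero, hzero, sub_zero] at key
  refine (isInvertible_mfderiv_extChartAt (I := 𝓘(ℝ, E'))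
    (mem_extChartAt_source (I := 𝓘(ℝ, E')) p)).injective ?_
  rw [map_zero]
  exact key.symm

variable {E : Type*} [NormedAddCommGroup E] [NormedSpace ℝ E] [FiniteDimensional ℝ E]
  {M : Type*} [TopologicalSpace M] [ChartedSpace E M] [IsManifold 𝓘(ℝ, E) ∞ M]

/-- The torsion of a connection along a map:
`Ω_X (df Y) - Ω_Y (df X) - df [X, Y] = T(df X, df Y)`. -/
theorem covAlong_pushforward_sub
    (Omega : CovariantDerivative 𝓘(ℝ, E') E' (TangentSpace 𝓘(ℝ, E') : N → Type _))
    {f : M → N} {x : M} (hf : ContMDiffAt 𝓘(ℝ, E) 𝓘(ℝ, E') 2 f x)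
    {X Y : Π x : M, TangentSpace 𝓘(ℝ, E) x}
    (hX : MDifferentiableAt 𝓘(ℝ, E) 𝓘(ℝ, E).tangent
      (fun y ↦ (⟨y, X y⟩ : TangentBundle 𝓘(ℝ, E) M)) x)
    (hY : MDifferentiableAt 𝓘(ℝ, E) 𝓘(ℝ, E).tangent
      (fun y ↦ (⟨y, Y y⟩ : TangentBundle 𝓘(ℝ, E) M)) x) :
    covAlong Omega f (pushforward f Y) x (X x) - covAlong Omega f (pushforward f X) x (Y x) =
      pushforward f (mlieBracket 𝓘(ℝ, E) X Y) x +
        Omega.torsion (f x) (pushforward f X x) (pushforward f Y x) := by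
  have : IsManifold 𝓘(ℝ, E) 1 M := .of_le (n := ∞) (by simp)
  have : IsManifold 𝓘(ℝ, E') 1 N := .of_le (n := ∞) (by simp)
  have : IsManifold 𝓘(ℝ, E') 2 N := .of_le (n := ∞) ENat.LEInfty.out
  set φ := extChartAt 𝓘(ℝ, E') (f x) with hφ
  set e := trivializationAt E' (TangentSpace 𝓘(ℝ, E') : N → Type _) (f x) with he
  have hchain : ∀ᶠ y in 𝓝 x, ∀ v : TangentSpace 𝓘(ℝ, E) y,
      (e ⟨f y, mfderiv 𝓘(ℝ, E) 𝓘(ℝ, E') f y v⟩).2 = mvfderiv 𝓘(ℝ, E) (φ ∘ f) y v := by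
    filter_upwards [hf.continuousAt.preimage_mem_nhds
      (extChartAt_source_mem_nhds (I := 𝓘(ℝ, E')) (f x)), 
      (contMDiffAt_iff_contMDiffAt_nhds (by simp)).1 hf] with y hy hfy v
    rw [trivializationAt_apply_snd hy]
    have hc := (mdifferentiableAt_extChartAt (I := 𝓘(ℝ, E')) (x := f x) (y := f y)
      (by simpa using hy)).hasMFDerivAt.comp y (hfy.mdifferentiableAt (by simp)).hasMFDerivAt
    change _ = mfderiv 𝓘(ℝ, E) 𝓘(ℝ, E') (φ ∘ f) y v
    rw [hc.mfderiv]
    rfl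
  have hF : ContMDiffAt 𝓘(ℝ, E) 𝓘(ℝ, E') 2 (φ ∘ f) x :=
    (contMDiffAt_extChartAt (n := 2)).comp x hf
  have hfield : ∀ (Z : Π x : M, TangentSpace 𝓘(ℝ, E) x) (v : TangentSpace 𝓘(ℝ, E) x),
      mvfderiv 𝓘(ℝ, E) (fun y ↦ (e ⟨f y, pushforward f Z y⟩).2) x v =
        mvfderiv 𝓘(ℝ, E) (fun y ↦ mvfderiv 𝓘(ℝ, E) (φ ∘ f) y (Z y)) x v := by
    intro Z v
    have h : (fun y ↦ (e ⟨f y, pushforward f Z y⟩).2) =ᶠ[𝓝 x]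
        fun y ↦ mvfderiv 𝓘(ℝ, E) (φ ∘ f) y (Z y) := by
      filter_upwards [hchain] with y hy using hy (Z y)
    rw [mvfderiv_congr h]
  have hsymm : e.symm (f x) (mvfderiv 𝓘(ℝ, E) (φ ∘ f) x (mlieBracket 𝓘(ℝ, E) X Y x)) =
      pushforward f (mlieBracket 𝓘(ℝ, E) X Y) x := by
    rw [← hchain.self_of_nhds]
    exact Trivialization.symm_apply_apply_mk _
      (FiberBundle.mem_baseSet_trivializationAt' (f x)) _
  -- On extensions constant in the trivialization the bracket vanishes, so the torsion is exactly
  -- the difference of the connection terms in `covAlong`. The derivative terms account for `df [X,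
  -- Y]`.
  have hT := Omega.torsion_apply_eq_extend (x := f x) (pushforward f X x) (pushforward f Y x)
  rw [mlieBracket_extend, sub_zero, FiberBundle.extend_apply_self,
    FiberBundle.extend_apply_self] at hT
  have hsub : ∀ a b : E', e.symm (f x) a - e.symm (f x) b = e.symm (f x) (a - b) := by
    intro a b
    have hb : f x ∈ e.baseSet := FiberBundle.mem_baseSet_trivializationAt' (f x)
    simp only [← e.symmL_apply (R := ℝ) hb, map_sub]
  rw [← hsymm, ← mvfderiv_mfderiv_sub hF hX hY, hT, ← hsub, ← hfield, ← hfield]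
  simp only [covAlong, pushforward]
  abel

end AmbientTorsion

/-! ### The distribution `B` and the Gauss decomposition. -/

variable {E : Type*} [NormedAddCommGroup E] [NormedSpace ℝ E] [FiniteDimensional ℝ E]
  {M : Type*} [TopologicalSpace M] [ChartedSpace E M] [IsManifold 𝓘(ℝ, E) ∞ M]
  {E' : Type*} [NormedAddCommGroup E'] [NormedSpace ℝ E'] [FiniteDimensional ℝ E']
  {N : Type*} [TopologicalSpace N] [ChartedSpace E' N] [IsManifold 𝓘(ℝ, E') ∞ N]
  {g : SemiRiemannianMetric E' N} {f : M → N}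

namespace LightlikeSubmanifold

variable (L : LightlikeSubmanifold E g f)
  (Omega : CovariantDerivative 𝓘(ℝ, E') E' (TangentSpace 𝓘(ℝ, E') : N → Type _))
  (J : Π x : N, TangentSpace 𝓘(ℝ, E') x →L[ℝ] TangentSpace 𝓘(ℝ, E') x)
  (X Y : Π x : M, TangentSpace 𝓘(ℝ, E) x)

omit [FiniteDimensional ℝ E] [IsManifold 𝓘(ℝ, E) ∞ M] [FiniteDimensional ℝ E'] in
theorem B_le_tangent (x : M) : L.B J x ≤ tangent E f x := by
  rw [← L.rad_sup_screen x]
  exact sup_le (inf_le_right.trans le_sup_right) le_sup_left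

omit [FiniteDimensional ℝ E] [IsManifold 𝓘(ℝ, E) ∞ M] [FiniteDimensional ℝ E'] in
/-- `B` is invariant under `J`. -/
theorem map_mem_B {J : Π x : N, TangentSpace 𝓘(ℝ, E') x →L[ℝ] TangentSpace 𝓘(ℝ, E') x}
    (hJ : ∀ (x : N) (v : TangentSpace 𝓘(ℝ, E') x), J x (J x v) = (3 : ℝ) • J x v + v)
    (hL : L.IsScreenGeneric J) {x : M} {v : TangentSpace 𝓘(ℝ, E') (f x)} (hv : v ∈ L.B J x) :
    J (f x) v ∈ L.B J x := by
  obtain ⟨a, ⟨⟨u, hu, rfl⟩, ha⟩, b, hb, rfl⟩ := Submodule.mem_sup.1 hv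
  rw [map_add]
  refine Submodule.add_mem_sup ⟨Submodule.mem_map_of_mem ha, ?_⟩ ?_
  -- An element of `B_o` is `Ju` with both `u` and `Ju` in the screen, so `J(Ju) = 3Ju + u` stays in
  -- the screen.
  · change J (f x) (J (f x) u) ∈ L.screen x
    rw [hJ]
    exact add_mem (Submodule.smul_mem _ _ ha) hu
  · rw [← hL.map_rad x]
    exact Submodule.mem_map_of_mem hb

/-- The induced connection inverts `df` on its image; applying `df` again lets membership be tested
on the ambient projection. -/
theorem pushforward_inducedConnection (x : M) :
    pushforward f (L.inducedConnection Omega X Y) x =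
      Submodule.projection (tangent E f x) (L.ltr x ⊔ L.screenTransversal x)
        (L.decomposition x).1 (ambientDeriv Omega X Y f x) :=
  congrArg Subtype.val ((LinearEquiv.ofInjective (mfderiv 𝓘(ℝ, E) 𝓘(ℝ, E') f x).toLinearMap
    (L.injective_mfderiv x)).apply_symm_apply _)

/-- For a subspace `D` of the tangent space, the ambient derivative lies in `D` if and only if the
second fundamental forms vanish and the induced derivative lies in `D`. -/
theorem ambientDeriv_mem_iff {D : Submodule ℝ (TangentSpace 𝓘(ℝ, E') (f x))}
    (hD : D ≤ tangent E f x) :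
    ambientDeriv Omega X Y f x ∈ D ↔ (L.hl Omega X Y x = 0 ∧ L.hs Omega X Y x = 0) ∧
      pushforward f (L.inducedConnection Omega X Y) x ∈ D := by
  rw [pushforward_inducedConnection]
  constructor
  · intro h
    refine ⟨⟨?_, ?_⟩, ?_⟩
    · exact (Submodule.projection_apply_eq_zero_iff _).2 (Submodule.mem_sup_left (hD h))
    · exact (Submodule.projection_apply_eq_zero_iff _).2 (Submodule.mem_sup_left (hD h))
    · rwa [Submodule.projection_apply_of_mem_left _ (hD h)]
  · rintro ⟨⟨hl, hs⟩, h⟩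
    -- Vanishing of `h^l` leaves `t + w` with `t` in `TM` and `w` in `S(TM^⊥)`; vanishing of `h^s`
    -- puts `w` in `TM ⊕ ltr(TM)` as well, so `w = 0`.
    obtain ⟨t, ht, w, hw, htw⟩ := Submodule.mem_sup.1
      ((Submodule.projection_apply_eq_zero_iff _).1 hl)
    have hs' := (Submodule.projection_apply_eq_zero_iff _).1 hs
    have hw' : w ∈ tangent E f x ⊔ L.ltr x := by
      rw [← htw] at hs'
      simpa using sub_mem hs' (Submodule.mem_sup_left ht)
    have hw0 : w = 0 := Submodule.disjoint_def.1 (L.decomposition x).2.2.disjoint w hw hw'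
    have hmem : ambientDeriv Omega X Y f x ∈ tangent E f x := by
      rwa [← htw, hw0, add_zero]
    rwa [Submodule.projection_apply_of_mem_left _ hmem] at h

end LightlikeSubmanifold

/-- If `D ⊆ TM` is closed under `J` and under the ambient derivative for an `(l,m)`-type
connection, then `D` is integrable. -/
theorem isIntegrable_of_ambientDeriv_mem
    {Omega : CovariantDerivative 𝓘(ℝ, E') E' (TangentSpace 𝓘(ℝ, E') : N → Type _)}
    {J : Π x : N, TangentSpace 𝓘(ℝ, E') x →L[ℝ] TangentSpace 𝓘(ℝ, E') x}
    {eta : Π x : N, TangentSpace 𝓘(ℝ, E') x} {l m : N → ℝ}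
    (hOmega : IsLMConnection g J eta l m Omega) (hf : ContMDiff 𝓘(ℝ, E) 𝓘(ℝ, E') ∞ f)
    {D : Π x : M, Submodule ℝ (TangentSpace 𝓘(ℝ, E') (f x))}
    (hJD : ∀ x, ∀ v ∈ D x, J (f x) v ∈ D x)
    (hD : ∀ X Y : Π x : M, TangentSpace 𝓘(ℝ, E) x, IsSection f D X → IsSection f D Y →
      ∀ x, LightlikeSubmanifold.ambientDeriv Omega X Y f x ∈ D x) :
    IsIntegrable E f D := by
  intro X Y hX hY x
  have h := covAlong_pushforward_sub Omega ((hf x).of_le ENat.LEInfty.out)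
    ((hX.1 x).mdifferentiableAt (by simp)) ((hY.1 x).mdifferentiableAt (by simp))
  rw [← sub_eq_iff_eq_add] at h
  rw [← h, hOmega.torsion_eq]
  have hX' := hX.2 x
  have hY' := hY.2 x
  -- Closure under the ambient derivative is used in both orders; the two remaining goals are the
  -- `l`- and `m`-parts of the torsion, and only the latter needs invariance under `J`.
  refine sub_mem (sub_mem (hD X Y hX hY x) (hD Y X hY hX x)) (add_mem ?_ ?_)
  · exact (D x).smul_mem _ (sub_mem ((D x).smul_mem _ hX') ((D x).smul_mem _ hY'))
  · exact (D x).smul_mem _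
      (sub_mem ((D x).smul_mem _ (hJD x _ hX')) ((D x).smul_mem _ (hJD x _ hY')))

end LightlikeGeometry

end

theorem mainTheorem9
    {E : Type*} [NormedAddCommGroup E] [NormedSpace ℝ E] [FiniteDimensional ℝ E]
    {M : Type*} [TopologicalSpace M] [T2Space M] [SecondCountableTopology M]
    [ChartedSpace E M] [IsManifold 𝓘(ℝ, E) ∞ M]
    {E' : Type*} [NormedAddCommGroup E'] [NormedSpace ℝ E'] [FiniteDimensional ℝ E']
    {N : Type*} [TopologicalSpace N] [T2Space N] [SecondCountableTopology N]
    [ChartedSpace E' N] [IsManifold 𝓘(ℝ, E') ∞ N]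
    (g : LightlikeGeometry.SemiRiemannianMetric E' N)
    (nabla : CovariantDerivative 𝓘(ℝ, E') E' (TangentSpace 𝓘(ℝ, E') : N → Type _))
    (J : Π x : N, TangentSpace 𝓘(ℝ, E') x →L[ℝ] TangentSpace 𝓘(ℝ, E') x)
    (hJ : LightlikeGeometry.IsLocallyBronze g nabla J)
    (eta : Π x : N, TangentSpace 𝓘(ℝ, E') x) (l m : N → ℝ)
    (Omega : CovariantDerivative 𝓘(ℝ, E') E' (TangentSpace 𝓘(ℝ, E') : N → Type _))
    (hOmega : LightlikeGeometry.IsLMConnection g J eta l m Omega)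
    (f : M → N) (L : LightlikeGeometry.LightlikeSubmanifold E g f)
    (hL : L.IsScreenGeneric J) :
    LightlikeGeometry.DefinesTotallyGeodesicFoliation E Omega f (L.B J) ↔
      L.IsGeodesicOn Omega (L.B J) ∧ L.IsParallel Omega (L.B J) := by
  constructor
  · rintro ⟨-, h⟩
    have h' := fun X Y hX hY x ↦
      (L.ambientDeriv_mem_iff Omega X Y (L.B_le_tangent J x)).1 (h X Y hX hY x)
    exact ⟨fun X Y hX hY x ↦ (h' X Y hX hY x).1, fun X Y hX hY x ↦ (h' X Y hX hY x).2⟩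
  · rintro ⟨hgeo, hpar⟩
    have h := fun X Y hX hY x ↦ (L.ambientDeriv_mem_iff Omega X Y (L.B_le_tangent J x)).2
      ⟨hgeo X Y hX hY x, hpar X Y hX hY x⟩
    -- Integrability is a consequence of the second clause `h`, so it requires no condition of its
    -- own.
    exact ⟨LightlikeGeometry.isIntegrable_of_ambientDeriv_mem hOmega L.contMDiff
      (fun x v hv ↦ L.map_mem_B hJ.bronze hL hv) h, h⟩
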